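/- **Setting.** Fix $d\ge 1$ and let $F:\mathbb R^d\to\mathbb R$ be five times continuously differentiable with minimizer $x^*$. Assume that $\nabla F$ is $M$-Lipschitz, that all eigenvalues of $\nabla^2F(x)$ are at least $m>0$ for every $x$, and that $\nabla^3F$ is bounded. Only noisy evaluations $f(x)$ are available, unbiased for $F(x)$, with standard deviation $\sigma(x)$ bounded in $x$. Starting from a deterministic $x_0$, run $x_{k+1}=x_k-a\,g_k$. Here $g_k$ is the Cor-CFD (correlation-induced central finite difference) estimate of $\nabla F(x_k)$, formed coordinate by coordinate from $n_k$ pairs of evaluations with i.i.d. noise seeds. (For each coordinate, the pairs are spread evenly over $K\ge2$ perturbations $h_r$. The bootstrap means of the difference quotients are regressed on $(1,h_r^2)$ and their bootstrap variances on $1/(2n_bh_r^2)$, $n_b=n_k/K$, which yields pilot estimates $\hat G,\hat B,\hat\sigma^2$ of the derivative, of the bias coefficient and of the noise variance. With $\hat h=(\hat\sigma^2/(4n_k\hat B^2))^{1/6}$, each quotient $q$ at $h_r$ is replaced by $\frac{h_r}{\hat h}(q-\hat G-\hat Bh_r^2)+\hat G+\hat B\hat h^2$, and all of these are averaged.) The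 batch sizes $n_k$ may be random. Let $\mathcal F_k=\sigma(x_1,\dots,x_k)$, $b_k=\mathbb E[g_k\mid\mathcal F_k]-\nabla F(x_k)$, $\epsilon_k=g_k-\mathbb E[g_k\mid\mathcal F_k]$, and assume $\mathbb E\|g_k\|^2<\infty$. Let $$0<\theta<\frac{m}{2M},\qquad 0<a\le\frac{1}{(2\theta^2+2\theta+1)M}.$$ Assume there is an a.s. positive integrable random variable $\mathcal C$ (for instance a constant), independent of $n_k$ for each $k$, such that for all $k\ge 0$, almost surely, $$\max\{\mathbb E[\|b_k\|^2\mid\mathcal F_k],\ \mathbb E[\|\epsilon_k\|^2\mid\mathcal F_k]\}\le \mathcal C\,n_k^{-2/3}\le\theta^2\|\nabla F(x_k)\|^2;$$ the second inequality is the rule by which the batch sizes are chosen. Put $\bar a=1-(m-2\theta M)a$, $\bar{\mathcal C}=\theta^2/\mathbb E[\mathcal C]$, and let $S_N=\mathbb E\big[\sum_{k<N}2d\,n_k\big]\in[0,\infty]$ be the expected number of function evaluations in the first $N$ iterations. **Theorem (sample complexity).** 1. For $\varepsilon>0$ let $K(\varepsilon)$ be the least $k\ge 0$ with $\bar a^{\,k}\|x_0-x^*\|^2\le\varepsilon$,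 i.e. the number of iterations that the linear rate $\bar a$ requires for accuracy $\varepsilon$, and let $\mathcal S(\varepsilon)=S_{K(\varepsilon)}$. Then $\mathbb E\|x_{K(\varepsilon)}-x^*\|^2\le\varepsilon$ and $$\mathcal S(\varepsilon)\ \ge\ \mathcal C_1\varepsilon^{-3/2}+\mathcal C_2,\qquad \mathcal C_1=\frac{4d(\bar{\mathcal C}M^2)^{-3/2}}{3\,\bar a^{-3/2}\log(1/\bar a)},\quad \mathcal C_2=-\frac{4d(\bar{\mathcal C}M^2\|x_0-x^*\|^2)^{-3/2}}{3\log(1/\bar a)}.$$ 2. The order $\varepsilon^{-3/2}$ is also necessary for the actual accuracy: $1-aM(1+\theta)>0$, and whenever $0<\varepsilon<\|x_0-x^*\|^2$ and $N\ge 0$ satisfy $\mathbb E\|x_N-x^*\|^2\le\varepsilon$, then $$S_N\ \ge\ 2d(\bar{\mathcal C}M^2)^{-3/2}\,(1-aM(1+\theta))^3\,\varepsilon^{-3/2}.$$ 3. If moreover the batch sizes are of the smallest admissible order, that is, for some $A$ and all $k$, $\mathbb E[n_k]\le A\,\big(\bar{\mathcal C}\,\mathbb E\|\nabla F(x_k)\|^2\big)^{-3/2}$,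 then every $S_N$ is finite and $\mathbb E\|x_N-x^*\|^2=O\big(S_N^{-2/3}\big)$ as $N\to\infty$, the rate of the Kiefer–Wolfowitz method. -/

import Mathlib

open MeasureTheory ProbabilityTheory
open scoped ENNReal

noncomputable section

namespace CorCFD

/-! ### Noisy zeroth-order oracle -/

/-- A noisy black box for `F : ℝᵈ → ℝ`: an evaluation at `x` returns `eval x u`, where the seed `u`
is drawn from `law`; it is an unbiased estimate of `F x` with finite variance. -/
structure NoisyOracle {d : ℕ} (F : EuclideanSpace ℝ (Fin d) → ℝ)
    (Ξ : Type*) [MeasurableSpace Ξ] where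
  law : Measure Ξ
  isProb : IsProbabilityMeasure law
  eval : EuclideanSpace ℝ (Fin d) → Ξ → ℝ
  measurable_eval : Measurable (Function.uncurry eval)
  memLp_eval : ∀ x, MemLp (eval x) 2 law
  unbiased : ∀ x, ∫ u, eval x u ∂law = F x

/-- The noise level `σ(x)`: the standard deviation of an evaluation at `x`. -/
def NoisyOracle.noise {d : ℕ} {F : EuclideanSpace ℝ (Fin d) → ℝ}
    {Ξ : Type*} [MeasurableSpace Ξ] (O : NoisyOracle F Ξ) (x : EuclideanSpace ℝ (Fin d)) : ℝ :=
  Real.sqrt (variance (O.eval x) O.law)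

/-! ### The correlation-induced central finite difference estimator (one coordinate)

There are `K` perturbations `h r` and `nb` sample pairs `yp r j`, `ym r j` (`j < nb`) at each of
them, where `yp r j` is a noisy value at the point shifted by `h r` and `ym r j` one at the point
shifted by `-h r`.  The total number of pairs is `K * nb`. -/

section Estimator

variable {K : ℕ}

/-- Average over the `K` perturbations. -/
def mean (z : Fin K → ℝ) : ℝ := (∑ r, z r) / K

/-- Slope of the least-squares regression of `y` on `(1, z)`. -/
def olsSlope (z y : Fin K → ℝ) : ℝ :=
  (∑ r, (z r - mean z) * (y r - mean y)) / ∑ r, (z r - mean z) ^ 2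

/-- Intercept of the least-squares regression of `y` on `(1, z)`. -/
def olsIntercept (z y : Fin K → ℝ) : ℝ := mean y - olsSlope z y * mean z

/-- Coefficient of the least-squares regression of `y` on `z` without intercept. -/
def olsThroughOrigin (z y : Fin K → ℝ) : ℝ := (∑ r, z r * y r) / ∑ r, z r ^ 2

/-- Central difference quotient of one sample pair. -/
def pairCFD (h : Fin K → ℝ) (yp ym : Fin K → ℕ → ℝ) (r : Fin K) (j : ℕ) : ℝ :=
  (yp r j - ym r j) / (2 * h r)

/-- The standard batch estimator `g_{nb, h r}`; it is also its own bootstrap expectation: the mean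
of `nb` draws with replacement from the `nb` quotients has this expectation. -/
def bootMean (nb : ℕ) (h : Fin K → ℝ) (yp ym : Fin K → ℕ → ℝ) (r : Fin K) : ℝ :=
  (∑ j ∈ Finset.range nb, pairCFD h yp ym r j) / nb

/-- Bootstrap variance of `g_{nb, h r}`: the variance of the mean of `nb` draws with replacement
from the `nb` quotients. -/
def bootVar (nb : ℕ) (h : Fin K → ℝ) (yp ym : Fin K → ℕ → ℝ) (r : Fin K) : ℝ :=
  (∑ j ∈ Finset.range nb, (pairCFD h yp ym r j - bootMean nb h yp ym r) ^ 2) / (nb : ℝ) ^ 2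

/-- Pilot estimate of the derivative (from `E g_{nb,h} ≈ F' + B h²`). -/
def pilotGrad (nb : ℕ) (h : Fin K → ℝ) (yp ym : Fin K → ℕ → ℝ) : ℝ :=
  olsIntercept (fun r => h r ^ 2) (bootMean nb h yp ym)

/-- Pilot estimate of the bias coefficient `B` (from `E g_{nb,h} ≈ F' + B h²`). -/
def pilotBias (nb : ℕ) (h : Fin K → ℝ) (yp ym : Fin K → ℕ → ℝ) : ℝ :=
  olsSlope (fun r => h r ^ 2) (bootMean nb h yp ym)

/-- Pilot estimate of `σ²` (from `Var g_{nb,h} ≈ σ² / (2 nb h²)`). -/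
def pilotVar (nb : ℕ) (h : Fin K → ℝ) (yp ym : Fin K → ℕ → ℝ) : ℝ :=
  olsThroughOrigin (fun r => 1 / (2 * nb * h r ^ 2)) (bootVar nb h yp ym)

/-- Estimated optimal perturbation `(σ̂² / (4 n B̂²))^{1/6}` with `n = K * nb`. -/
def optPert (nb : ℕ) (h : Fin K → ℝ) (yp ym : Fin K → ℕ → ℝ) : ℝ :=
  (pilotVar nb h yp ym / (4 * ((K * nb : ℕ) : ℝ) * pilotBias nb h yp ym ^ 2)) ^ (1 / 6 : ℝ)

/-- Adjusted difference quotient: every pilot pair is rescaled to the estimated optimal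
perturbation. -/
def adjusted (nb : ℕ) (h : Fin K → ℝ) (yp ym : Fin K → ℕ → ℝ) (r : Fin K) (j : ℕ) : ℝ :=
  h r / optPert nb h yp ym *
      (pairCFD h yp ym r j - pilotGrad nb h yp ym - pilotBias nb h yp ym * h r ^ 2)
    + pilotGrad nb h yp ym + pilotBias nb h yp ym * optPert nb h yp ym ^ 2

/-- The Cor-CFD estimator: the average of all adjusted quotients. -/
def corCFD (nb : ℕ) (h : Fin K → ℝ) (yp ym : Fin K → ℕ → ℝ) : ℝ :=
  (∑ r, ∑ j ∈ Finset.range nb, adjusted nb h yp ym r j) / ((K * nb : ℕ) : ℝ)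

end Estimator

/-! ### The algorithm with constant step size -/

section Algorithm

variable {d K : ℕ} {Ω Ξ : Type*} [MeasurableSpace Ξ]

/-- Labels of the function evaluations:
(iteration, coordinate, perturbation, replication, sign of the perturbation). -/
abbrev EvalIndex (d K : ℕ) : Type := ℕ × Fin d × Fin K × ℕ × Bool

/-- The Cor-CFD estimate `g_k(x_k)` of `∇F(x_k)`, computed coordinate by coordinate from the noisy
values at `x_k ± h_{k,i,r} e_i`, with `nb k` pairs at each of the `K` perturbations. -/
def gradEst {F : EuclideanSpace ℝ (Fin d) → ℝ} (O : NoisyOracle F Ξ)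
    (ξ : EvalIndex d K → Ω → Ξ) (h : ℕ → Fin d → Fin K → Ω → ℝ) (nb : ℕ → Ω → ℕ)
    (x : ℕ → Ω → EuclideanSpace ℝ (Fin d)) (k : ℕ) (ω : Ω) : EuclideanSpace ℝ (Fin d) :=
  WithLp.toLp 2 fun i : Fin d =>
    corCFD (nb k ω) (fun r => h k i r ω)
      (fun r j => O.eval (x k ω + h k i r ω • EuclideanSpace.single i (1 : ℝ))
        (ξ (k, i, r, j, true) ω))
      (fun r j => O.eval (x k ω - h k i r ω • EuclideanSpace.single i (1 : ℝ))
        (ξ (k, i, r, j, false) ω))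

/-- Number of sample pairs per coordinate at iteration `k`: `n_k = K * nb k`. -/
def pairs (K : ℕ) (nb : ℕ → Ω → ℕ) (k : ℕ) (ω : Ω) : ℕ := K * nb k ω

/-- The σ-field `𝓕_k = σ{x_1, …, x_k}`. -/
@[reducible] def history (x : ℕ → Ω → EuclideanSpace ℝ (Fin d)) (k : ℕ) : MeasurableSpace Ω :=
  ⨆ j ∈ Finset.Icc 1 k, MeasurableSpace.comap (x j) inferInstance

variable [MeasurableSpace Ω]

/-- `x` is a run of `x_{k+1} = x_k - a g_k(x_k)` from `x₀`, with `g_k` the Cor-CFD estimate from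
i.i.d. seeds.  The perturbations `h` and the (adaptive) batch sizes `nb` may be random. -/
structure IsRun {F : EuclideanSpace ℝ (Fin d) → ℝ} (μ : Measure Ω) (O : NoisyOracle F Ξ)
    (ξ : EvalIndex d K → Ω → Ξ) (h : ℕ → Fin d → Fin K → Ω → ℝ) (nb : ℕ → Ω → ℕ)
    (a : ℝ) (x₀ : EuclideanSpace ℝ (Fin d)) (x : ℕ → Ω → EuclideanSpace ℝ (Fin d)) : Prop where
  two_le : 2 ≤ K
  measurable_seed : ∀ e, Measurable (ξ e)
  law_seed : ∀ e, μ.map (ξ e) = O.law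
  indep_seed : iIndepFun ξ μ
  measurable_pert : ∀ k i r, Measurable (h k i r)
  pert_ne_zero : ∀ k i r, ∀ᵐ ω ∂μ, h k i r ω ≠ 0
  pert_distinct : ∀ k i, ∀ᵐ ω ∂μ, Function.Injective fun r => |h k i r ω|
  measurable_batch : ∀ k, Measurable (nb k)
  batch_pos : ∀ k ω, 0 < nb k ω
  measurable_iterate : ∀ k, Measurable (x k)
  zero : ∀ ω, x 0 ω = x₀
  step : ∀ k ω, x (k + 1) ω = x k ω - a • gradEst O ξ h nb x k ω

/-- The bias `b_k = E[g_k | 𝓕_k] - ∇F(x_k)` of a sequence of gradient estimates `g`. -/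
def bias (μ : Measure Ω) (F : EuclideanSpace ℝ (Fin d) → ℝ)
    (x g : ℕ → Ω → EuclideanSpace ℝ (Fin d)) (k : ℕ) (ω : Ω) : EuclideanSpace ℝ (Fin d) :=
  (μ[g k | history x k]) ω - gradient F (x k ω)

/-- The noise term `ε_k = g_k - E[g_k | 𝓕_k]`. -/
def noiseTerm (μ : Measure Ω) (x g : ℕ → Ω → EuclideanSpace ℝ (Fin d)) (k : ℕ) (ω : Ω) :
    EuclideanSpace ℝ (Fin d) :=
  g k ω - (μ[g k | history x k]) ω

/-- Mean squared error `E‖x_k - x*‖²` of the `k`-th iterate. -/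
def mse (μ : Measure Ω) (x : ℕ → Ω → EuclideanSpace ℝ (Fin d))
    (xs : EuclideanSpace ℝ (Fin d)) (k : ℕ) : ℝ :=
  ∫ ω, ‖x k ω - xs‖ ^ 2 ∂μ

/-- Expected total number of function evaluations in the iterations `0, …, N - 1`; iteration `k`
uses `2 d n_k` of them. The value may be `∞`. -/
def totalEvals (μ : Measure Ω) (d K : ℕ) (nb : ℕ → Ω → ℕ) (N : ℕ) : ℝ≥0∞ :=
  ∫⁻ ω, ((∑ k ∈ Finset.range N, 2 * d * pairs K nb k ω : ℕ) : ℝ≥0∞) ∂μ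

end Algorithm

/-! ### Constants -/

/-- The linear rate `ā = 1 - (m - 2 θ M) a`. -/
def rate (m M θ a : ℝ) : ℝ := 1 - (m - 2 * θ * M) * a

/-- `K(ε)`: the least number `k` of iterations for which the linear rate brings the squared initial
error `R = ‖x₀ - x*‖²` down to `ε`, that is, `āᵏ R ≤ ε`. -/
def iterations (abar R ε : ℝ) : ℕ := sInf {k : ℕ | abar ^ k * R ≤ ε}

/-- `C₁`, in terms of `C̄`, `M` and `ā`. -/
def const₁ (d : ℕ) (Cbar M abar : ℝ) : ℝ :=
  4 * d * (Cbar * M ^ 2) ^ (-(3 / 2) : ℝ) /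
    (3 * abar ^ (-(3 / 2) : ℝ) * Real.log (1 / abar))

/-- `C₂` (negative), in terms of `C̄`, `M`, `R = ‖x₀ - x*‖²` and `ā`. -/
def const₂ (d : ℕ) (Cbar M R abar : ℝ) : ℝ :=
  -(4 * d * (Cbar * M ^ 2 * R) ^ (-(3 / 2) : ℝ) / (3 * Real.log (1 / abar)))

end CorCFD

end

/-! Everything rests on two facts about V_k = E‖x_k − x*‖². A step splits into an 𝓕_k-measurable
part and the noise ε_k, orthogonal in L², and bias and noise are both of relative size θ against
∇F(x_k). Hence c²V_k ≤ V_{k+1} ≤ āV_k with c = 1 − aM(1+θ) (`integral_norm_sub_smul_sq_bounds`): the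
upper bound comes from strong monotonicity and cocoercivity of ∇F (`gradient_bounds`), the lower one
from the Lipschitz and bias bounds.

The sampling rule, independence of C and n_k, and Jensen for z ↦ z^(-3/2) give E n_k ≥
(C̄M²V_k)^(-3/2) (`ofReal_rpow_le_lintegral_batch`).

The rest concerns sequences. Since V_k ≤ ā^k R, the costs have a geometrically growing floor, whose
sum gives C₁ and C₂. The last iteration before accuracy ε starts from an error at most ε/c², so its
batch alone costs order ε^(-3/2). Finally, costs of order V_k^(-3/2) decay geometrically backwards
from N, so S_N is at most a multiple of V_N^(-3/2). -/

namespace CorCFD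

open scoped RealInnerProductSpace

/-! ### Spectral bounds for symmetric operators -/

section Operator

variable {V : Type*} [NormedAddCommGroup V] [InnerProductSpace ℝ V] [FiniteDimensional ℝ V]

/-- A symmetric operator with norm at most `M` and eigenvalues at least `m > 0` is bounded below
by `m`, and it is cocoercive. -/
lemma symmetric_bounds (A : V →L[ℝ] V) (hA : (A : V →ₗ[ℝ] V).IsSymmetric) {m M : ℝ}
    (hm : 0 < m) (hM : ‖A‖ ≤ M)
    (hev : ∀ l : ℝ, Module.End.HasEigenvalue (A : V →ₗ[ℝ] V) l → m ≤ l) (v : V) :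
    m * ‖v‖ ^ 2 ≤ ⟪A v, v⟫ ∧ ‖A v‖ ^ 2 ≤ M * ⟪A v, v⟫ := by
  -- In an orthonormal eigenbasis the claims decouple into m ≤ l and l² ≤ M l for each eigenvalue l;
  -- the latter uses 0 ≤ l ≤ M.
  have hn : Module.finrank ℝ V = Module.finrank ℝ V := rfl
  set b := hA.eigenvectorBasis hn with hb
  set l := hA.eigenvalues hn with hl
  have hml : ∀ i, m ≤ l i := fun i => hev _ (hA.hasEigenvalue_eigenvalues hn i)
  have hlM : ∀ i, l i ≤ M := fun i => by
    have h1 : A (b i) = l i • b i := hA.apply_eigenvectorBasis hn i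
    have h2 := A.le_opNorm (b i)
    rw [h1, norm_smul, b.norm_eq_one, mul_one, mul_one] at h2
    exact ((le_abs_self _).trans h2).trans hM
  have hAi : ∀ i, b.repr (A v) i = l i * b.repr v i := fun i =>
    hA.eigenvectorBasis_apply_self_apply hn v i
  have e1 : ‖v‖ ^ 2 = ∑ i, b.repr v i ^ 2 := by
    rw [← b.repr.norm_map v, EuclideanSpace.real_norm_sq_eq]
  have e2 : ‖A v‖ ^ 2 = ∑ i, (l i * b.repr v i) ^ 2 := by
    rw [← b.repr.norm_map (A v), EuclideanSpace.real_norm_sq_eq]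
    simp only [hAi]
  have e3 : ⟪A v, v⟫ = ∑ i, l i * b.repr v i ^ 2 := by
    rw [← b.repr.inner_map_map, PiLp.inner_apply]
    refine Finset.sum_congr rfl fun i _ => ?_
    rw [hAi]
    simp only [RCLike.inner_apply, conj_trivial]
    ring
  rw [e1, e2, e3, Finset.mul_sum, Finset.mul_sum]
  constructor <;> refine Finset.sum_le_sum fun i _ => ?_
  · exact mul_le_mul_of_nonneg_right (hml i) (sq_nonneg _)
  · have h0 : 0 ≤ l i * b.repr v i ^ 2 :=
      mul_nonneg (hm.le.trans (hml i)) (sq_nonneg _)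
    calc (l i * b.repr v i) ^ 2 = l i * (l i * b.repr v i ^ 2) := by ring
      _ ≤ M * (l i * b.repr v i ^ 2) := mul_le_mul_of_nonneg_right (hlM i) h0

end Operator

/-! ### Strong monotonicity, cocoercivity, and one inexact gradient step -/

section Gradient

variable {V : Type*} [NormedAddCommGroup V] [InnerProductSpace ℝ V] [FiniteDimensional ℝ V]

lemma gradient_eq_toDual_symm_comp (F : V → ℝ) :
    gradient F = fun y => (InnerProductSpace.toDual ℝ V).symm (fderiv ℝ F y) := rfl

lemma differentiable_gradient {F : V → ℝ} (hF : ContDiff ℝ 2 F) :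
    Differentiable ℝ (gradient F) := by
  rw [gradient_eq_toDual_symm_comp]
  have h1 : Differentiable ℝ (fderiv ℝ F) :=
    (hF.fderiv_right (m := 1) (by norm_num)).differentiable (by norm_num)
  exact (InnerProductSpace.toDual ℝ V).symm.toContinuousLinearEquiv.differentiable.comp h1

lemma inner_fderiv_gradient {F : V → ℝ} (hF : ContDiff ℝ 2 F) (y v w : V) :
    ⟪fderiv ℝ (gradient F) y v, w⟫ = fderiv ℝ (fderiv ℝ F) y v w := by
  have h1 : DifferentiableAt ℝ (fderiv ℝ F) y :=
    (hF.fderiv_right (m := 1) (by norm_num)).differentiable (by norm_num) y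
  have h2 := (innerSL ℝ w).hasFDerivAt.comp y (differentiable_gradient hF y).hasFDerivAt
  have h3 := (ContinuousLinearMap.apply ℝ ℝ w).hasFDerivAt.comp y h1.hasFDerivAt
  have h4 : innerSL ℝ w ∘ gradient F = ContinuousLinearMap.apply ℝ ℝ w ∘ fderiv ℝ F := by
    funext z
    simp only [Function.comp_apply, innerSL_apply_apply, ContinuousLinearMap.apply_apply]
    rw [real_inner_comm]
    exact InnerProductSpace.toDual_symm_apply
  rw [h4] at h2
  have h5 := DFunLike.congr_fun (h2.unique h3) v
  rw [real_inner_comm]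
  exact h5

lemma isSymmetric_fderiv_gradient {F : V → ℝ} (hF : ContDiff ℝ 2 F) (y : V) :
    (fderiv ℝ (gradient F) y : V →ₗ[ℝ] V).IsSymmetric := by
  intro v w
  have hs : IsSymmSndFDerivAt ℝ F y := hF.contDiffAt.isSymmSndFDerivAt (by simp)
  have h1 := inner_fderiv_gradient hF y v w
  have h2 := inner_fderiv_gradient hF y w v
  rw [real_inner_comm] at h2
  exact h1.trans ((hs v w).trans h2.symm)

/-- Strong monotonicity and cocoercivity of the gradient of a function whose Hessian has
eigenvalues at least `m > 0` and whose gradient is `M`-Lipschitz. -/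
lemma gradient_bounds {F : V → ℝ} (hF : ContDiff ℝ 2 F) {m M : ℝ} (hm : 0 < m) (hM : 0 ≤ M)
    (hLip : ∀ y z, ‖gradient F y - gradient F z‖ ≤ M * ‖y - z‖)
    (hconv : ∀ y (l : ℝ),
      Module.End.HasEigenvalue (fderiv ℝ (gradient F) y : V →ₗ[ℝ] V) l → m ≤ l) (y z : V) :
    m * ‖z - y‖ ^ 2 ≤ ⟪gradient F z - gradient F y, z - y⟫ ∧
      ‖gradient F z - gradient F y‖ ^ 2 ≤ M * ⟪gradient F z - gradient F y, z - y⟫ := by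
  set v := z - y with hv
  set G := gradient F z - gradient F y with hG
  have hb : ∀ t : ℝ, _ := fun t : ℝ =>
    symmetric_bounds (fderiv ℝ (gradient F) (y + t • v))
      (isSymmetric_fderiv_gradient hF _) hm
      (norm_fderiv_le_of_lip' ℝ hM (Filter.Eventually.of_forall fun x => hLip x _))
      (hconv _) v
  have hder : ∀ t : ℝ, HasDerivAt (fun t : ℝ => gradient F (y + t • v))
      (fderiv ℝ (gradient F) (y + t • v) v) t := fun t => by
    have h1 : HasDerivAt (fun t : ℝ => y + t • v) v t := by
      simpa using ((hasDerivAt_id t).smul_const v).const_add y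
    exact ((differentiable_gradient hF (y + t • v)).hasFDerivAt).comp_hasDerivAt t h1
  -- G is the average of the Hessian applied to v along the segment, so affine inequalities valid at
  -- every t pass to G. Monotonicity of a scalar function replaces the integral.
  have key : ∀ (w : V) (c : ℝ),
      (∀ t : ℝ, 0 ≤ ⟪fderiv ℝ (gradient F) (y + t • v) v, w⟫ + c) → 0 ≤ ⟪G, w⟫ + c := by
    intro w c h
    have hd : ∀ t : ℝ, HasDerivAt (fun t : ℝ => ⟪gradient F (y + t • v), w⟫ + t * c)
        (⟪fderiv ℝ (gradient F) (y + t • v) v, w⟫ + c) t := fun t => by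
      have h1 := (hder t).inner ℝ (hasDerivAt_const t w)
      have h2 := (hasDerivAt_id t).mul_const c
      have h3 := h1.add h2
      simp only [inner_zero_right, zero_add, one_mul] at h3
      exact h3
    have hmono : Monotone fun t : ℝ => ⟪gradient F (y + t • v), w⟫ + t * c :=
      monotone_of_deriv_nonneg (fun t => (hd t).differentiableAt)
        (fun t => by rw [(hd t).deriv]; exact h t)
    have h01 := hmono zero_le_one
    simp only [zero_smul, add_zero, zero_mul, one_smul, one_mul] at h01
    have hz : y + v = z := by rw [hv]; abel
    rw [hz] at h01
    rw [hG, inner_sub_left]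
    linarith
  constructor
  · have := key v (-(m * ‖v‖ ^ 2)) fun t => by linarith [(hb t).1]
    linarith
  -- Linearizing the square, ‖Hv‖² ≥ 2⟪Hv, G⟫ − ‖G‖², makes the quadratic bound ‖Hv‖² ≤ M⟪Hv, v⟫
  -- affine in Hv, which dictates this choice of w and c.
  · have := key (M • v - (2 : ℝ) • G) (‖G‖ ^ 2) fun t => by
      have h1 := (hb t).2
      have h2 := norm_sub_sq_real (fderiv ℝ (gradient F) (y + t • v) v) G
      have h3 := sq_nonneg ‖fderiv ℝ (gradient F) (y + t • v) v - G‖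
      rw [inner_sub_right, inner_smul_right, inner_smul_right]
      linarith
    rw [inner_sub_right, inner_smul_right, inner_smul_right, real_inner_self_eq_norm_sq] at this
    linarith

lemma gradient_eq_zero_of_isMin {F : V → ℝ} {xs : V} (hxs : ∀ y, F xs ≤ F y) :
    gradient F xs = 0 := by
  have h : IsLocalMin F xs := Filter.Eventually.of_forall hxs
  rw [gradient_eq_toDual_symm_comp]
  simp [h.fderiv_eq_zero]

omit [FiniteDimensional ℝ V] in
/-- One inexact gradient step with relative bias at most `θ`: with `D` the distance to the
minimizer, `G` the gradient and `b` the bias. -/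
lemma step_upper {m M θ a : ℝ} (hM : 0 < M) (hθ : 0 ≤ θ) (ha₀ : 0 ≤ a)
    (ha : a * ((2 * θ ^ 2 + 2 * θ + 1) * M) ≤ 1) {D G b : V}
    (hLip : ‖G‖ ≤ M * ‖D‖) (h₁ : m * ‖D‖ ^ 2 ≤ ⟪G, D⟫) (h₂ : ‖G‖ ^ 2 ≤ M * ⟪G, D⟫)
    (hb : ‖b‖ ≤ θ * ‖G‖) :
    ‖D - a • (G + b)‖ ^ 2 + a ^ 2 * (θ ^ 2 * ‖G‖ ^ 2) ≤ rate m M θ a * ‖D‖ ^ 2 := by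
  have e1 : ‖D - a • (G + b)‖ ^ 2
      = ‖D‖ ^ 2 - 2 * a * ⟪G, D⟫ - 2 * a * ⟪D, b⟫ + a ^ 2 * ‖G + b‖ ^ 2 := by
    rw [norm_sub_sq_real, inner_smul_right, inner_add_right, norm_smul, real_inner_comm,
      Real.norm_eq_abs, mul_pow, sq_abs]
    ring
  have hGD : 0 ≤ ‖G‖ := norm_nonneg G
  have e2 : -⟪D, b⟫ ≤ θ * M * ‖D‖ ^ 2 := by
    calc -⟪D, b⟫ ≤ ‖D‖ * ‖b‖ := by
          have := abs_real_inner_le_norm D b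
          exact (neg_le_abs _).trans this
      _ ≤ ‖D‖ * (θ * (M * ‖D‖)) := by
          gcongr
          exact hb.trans (by gcongr)
      _ = θ * M * ‖D‖ ^ 2 := by ring
  have e3 : ‖G + b‖ ^ 2 ≤ (1 + θ) ^ 2 * ‖G‖ ^ 2 := by
    rw [← mul_pow]
    gcongr
    calc ‖G + b‖ ≤ ‖G‖ + ‖b‖ := norm_add_le _ _
      _ ≤ (1 + θ) * ‖G‖ := by linarith
  -- The constant is (1+θ)² + θ²: squared biased step plus variance. Of the gain 2a⟪G, D⟫, one half
  -- absorbs these terms and the other yields the contraction by m.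
  have e4 : a ^ 2 * (2 * θ ^ 2 + 2 * θ + 1) * ‖G‖ ^ 2 ≤ a * ⟪G, D⟫ := by
    have hGD : 0 ≤ ⟪G, D⟫ := nonneg_of_mul_nonneg_right ((sq_nonneg _).trans h₂) hM
    calc a ^ 2 * (2 * θ ^ 2 + 2 * θ + 1) * ‖G‖ ^ 2
        ≤ a ^ 2 * (2 * θ ^ 2 + 2 * θ + 1) * (M * ⟪G, D⟫) := by gcongr
      _ = a * (a * ((2 * θ ^ 2 + 2 * θ + 1) * M)) * ⟪G, D⟫ := by ring
      _ ≤ a * 1 * ⟪G, D⟫ := by gcongr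
      _ = a * ⟪G, D⟫ := by ring
  have e5 : a ^ 2 * ‖G + b‖ ^ 2 ≤ a ^ 2 * ((1 + θ) ^ 2 * ‖G‖ ^ 2) := by gcongr
  have e6 : a * -⟪D, b⟫ ≤ a * (θ * M * ‖D‖ ^ 2) := by gcongr
  have e7 : a * (m * ‖D‖ ^ 2) ≤ a * ⟪G, D⟫ := by gcongr
  rw [e1, rate]
  linarith

-- The displacement is at most aM(1+θ)‖D‖, so the reverse triangle inequality prevents the error
-- from shrinking too fast in one step.
omit [FiniteDimensional ℝ V] in
lemma step_lower {M θ a : ℝ} (hθ : 0 ≤ θ) (ha₀ : 0 ≤ a)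
    (hc : 0 ≤ 1 - a * M * (1 + θ)) {D G b : V}
    (hLip : ‖G‖ ≤ M * ‖D‖) (hb : ‖b‖ ≤ θ * ‖G‖) :
    (1 - a * M * (1 + θ)) ^ 2 * ‖D‖ ^ 2 ≤ ‖D - a • (G + b)‖ ^ 2 := by
  rw [← mul_pow]
  gcongr
  have h1 : ‖a • (G + b)‖ ≤ a * ((1 + θ) * (M * ‖D‖)) := by
    rw [norm_smul, Real.norm_of_nonneg ha₀]
    gcongr
    calc ‖G + b‖ ≤ ‖G‖ + ‖b‖ := norm_add_le _ _
      _ ≤ (1 + θ) * ‖G‖ := by linarith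
      _ ≤ _ := by gcongr
  have h2 := norm_sub_norm_le D (a • (G + b))
  linarith

end Gradient

end CorCFD

namespace CorCFD

open scoped RealInnerProductSpace

/-! ### Mean squared error of one stochastic step -/

section OneStep

variable {Ω V : Type*} {mΩ : MeasurableSpace Ω} {μ : Measure Ω}
  [NormedAddCommGroup V] [InnerProductSpace ℝ V]

omit [InnerProductSpace ℝ V] in
lemma integrable_norm_sq {f : Ω → V} (hf : MemLp f 2 μ) : Integrable (fun ω => ‖f ω‖ ^ 2) μ :=
  hf.integrable_norm_pow (p := 2) two_ne_zero

lemma integrable_inner {f g : Ω → V} (hf : MemLp f 2 μ) (hg : MemLp g 2 μ) :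
    Integrable (fun ω => ⟪f ω, g ω⟫) μ := by
  have h := (((integrable_norm_sq (hf.add hg)).sub (integrable_norm_sq hf)).sub
    (integrable_norm_sq hg)).div_const 2
  refine h.congr (Filter.Eventually.of_forall fun ω => ?_)
  simp only [Pi.sub_apply, Pi.add_apply]
  rw [norm_add_sq_real]
  ring

variable [CompleteSpace V] [IsProbabilityMeasure μ]

/-- The noise `g - E[g | 𝓖]` is orthogonal to every square-integrable `𝓖`-measurable vector. -/
lemma integral_inner_sub_condExp {𝓖 : MeasurableSpace Ω} (h𝓖 : 𝓖 ≤ mΩ) {Y g : Ω → V}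
    (hY : StronglyMeasurable[𝓖] Y) (hY2 : MemLp Y 2 μ) (hg : MemLp g 2 μ) :
    ∫ ω, ⟪Y ω, g ω - (μ[g | 𝓖]) ω⟫ ∂μ = 0 := by
  have hε : MemLp (g - μ[g | 𝓖]) 2 μ := hg.sub (hg.condExp one_le_two)
  have hgi : Integrable g μ := hg.integrable one_le_two
  have h1 := condExp_bilin_of_stronglyMeasurable_left (innerSL ℝ) hY
    (integrable_inner hY2 hε) (hε.integrable one_le_two)
  have h2 : μ[g - μ[g | 𝓖] | 𝓖] =ᵐ[μ] 0 := by
    refine (condExp_sub hgi integrable_condExp 𝓖).trans ?_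
    rw [condExp_of_stronglyMeasurable h𝓖 stronglyMeasurable_condExp integrable_condExp, sub_self]
  calc ∫ ω, ⟪Y ω, g ω - (μ[g | 𝓖]) ω⟫ ∂μ
      = ∫ ω, (μ[fun ω => innerSL ℝ (Y ω) ((g - μ[g | 𝓖]) ω) | 𝓖]) ω ∂μ :=
        (integral_condExp h𝓖).symm
    _ = ∫ _, (0 : ℝ) ∂μ := by
        refine integral_congr_ae ?_
        filter_upwards [h1, h2] with ω hω1 hω2
        rw [hω1, hω2]
        simp
    _ = 0 := by simp

/-- Pythagoras in L²: the cross term vanishes because Y is 𝓖-measurable. -/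
lemma integral_norm_sub_smul_sq {𝓖 : MeasurableSpace Ω} (h𝓖 : 𝓖 ≤ mΩ) {Y g : Ω → V}
    (hY : StronglyMeasurable[𝓖] Y) (hY2 : MemLp Y 2 μ) (hg : MemLp g 2 μ) (a : ℝ) :
    ∫ ω, ‖Y ω - a • (g ω - (μ[g | 𝓖]) ω)‖ ^ 2 ∂μ
      = ∫ ω, ‖Y ω‖ ^ 2 ∂μ + a ^ 2 * ∫ ω, ‖g ω - (μ[g | 𝓖]) ω‖ ^ 2 ∂μ := by
  have hε : MemLp (fun ω => g ω - (μ[g | 𝓖]) ω) 2 μ := hg.sub (hg.condExp one_le_two)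
  have h1 : ∀ ω, ‖Y ω - a • (g ω - (μ[g | 𝓖]) ω)‖ ^ 2
      = ‖Y ω‖ ^ 2 - 2 * a * ⟪Y ω, g ω - (μ[g | 𝓖]) ω⟫
        + a ^ 2 * ‖g ω - (μ[g | 𝓖]) ω‖ ^ 2 := fun ω => by
    rw [norm_sub_sq_real, inner_smul_right, norm_smul, mul_pow, Real.norm_eq_abs, sq_abs]
    ring
  simp only [h1]
  have i1 := integrable_norm_sq hY2
  have i2 := (integrable_inner hY2 hε).const_mul (2 * a)
  have i3 := (integrable_norm_sq hε).const_mul (a ^ 2)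
  have i12 : Integrable (fun ω => ‖Y ω‖ ^ 2 - 2 * a * ⟪Y ω, g ω - (μ[g | 𝓖]) ω⟫) μ := i1.sub i2
  rw [integral_add i12 i3, integral_sub i1 i2, integral_const_mul, integral_const_mul,
    integral_inner_sub_condExp h𝓖 hY hY2 hg]
  ring

/-- One step of stochastic gradient descent whose bias and variance, conditionally on `𝓖`, are at
most `θ² ‖G‖²`: the mean squared distance contracts at most by `(1 - a M (1 + θ))²` and at least
by `rate m M θ a`. -/
lemma integral_norm_sub_smul_sq_bounds {𝓖 : MeasurableSpace Ω} (h𝓖 : 𝓖 ≤ mΩ)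
    {m M θ a : ℝ} (hM : 0 < M) (hθ : 0 ≤ θ) (ha₀ : 0 ≤ a)
    (ha : a * ((2 * θ ^ 2 + 2 * θ + 1) * M) ≤ 1) (hc : 0 ≤ 1 - a * M * (1 + θ))
    {D G g : Ω → V} (hD : StronglyMeasurable[𝓖] D) (hG : StronglyMeasurable[𝓖] G)
    (hD2 : MemLp D 2 μ) (hg : MemLp g 2 μ)
    (hLip : ∀ ω, ‖G ω‖ ≤ M * ‖D ω‖) (h₁ : ∀ ω, m * ‖D ω‖ ^ 2 ≤ ⟪G ω, D ω⟫)
    (h₂ : ∀ ω, ‖G ω‖ ^ 2 ≤ M * ⟪G ω, D ω⟫)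
    (hb : ∀ᵐ ω ∂μ, (μ[fun ω' => ‖(μ[g | 𝓖]) ω' - G ω'‖ ^ 2 | 𝓖]) ω ≤ θ ^ 2 * ‖G ω‖ ^ 2)
    (hε : ∀ᵐ ω ∂μ, (μ[fun ω' => ‖g ω' - (μ[g | 𝓖]) ω'‖ ^ 2 | 𝓖]) ω ≤ θ ^ 2 * ‖G ω‖ ^ 2) :
    (1 - a * M * (1 + θ)) ^ 2 * ∫ ω, ‖D ω‖ ^ 2 ∂μ ≤ ∫ ω, ‖D ω - a • g ω‖ ^ 2 ∂μ ∧
      ∫ ω, ‖D ω - a • g ω‖ ^ 2 ∂μ ≤ rate m M θ a * ∫ ω, ‖D ω‖ ^ 2 ∂μ := by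
  have hG2 : MemLp G 2 μ := hD2.of_le_mul (hG.mono h𝓖).aestronglyMeasurable
    (Filter.Eventually.of_forall hLip)
  have hbm : StronglyMeasurable[𝓖] fun ω => (μ[g | 𝓖]) ω - G ω :=
    stronglyMeasurable_condExp.sub hG
  have hb2 : MemLp (fun ω => (μ[g | 𝓖]) ω - G ω) 2 μ := (hg.condExp one_le_two).sub hG2
  have hε2 : MemLp (fun ω => g ω - (μ[g | 𝓖]) ω) 2 μ := hg.sub (hg.condExp one_le_two)
  -- The bias is 𝓖-measurable, so its conditional second moment is its own square and the bound
  -- holds pointwise.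
  have hb' : ∀ᵐ ω ∂μ, ‖(μ[g | 𝓖]) ω - G ω‖ ≤ θ * ‖G ω‖ := by
    have h : μ[fun ω => ‖(μ[g | 𝓖]) ω - G ω‖ ^ 2 | 𝓖] = fun ω => ‖(μ[g | 𝓖]) ω - G ω‖ ^ 2 :=
      condExp_of_stronglyMeasurable h𝓖 (hbm.norm.pow 2) (integrable_norm_sq hb2)
    rw [h] at hb
    filter_upwards [hb] with ω hω
    rw [← mul_pow] at hω
    exact le_of_sq_le_sq hω (by positivity)
  have hεint : ∫ ω, ‖g ω - (μ[g | 𝓖]) ω‖ ^ 2 ∂μ ≤ ∫ ω, θ ^ 2 * ‖G ω‖ ^ 2 ∂μ := by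
    rw [← integral_condExp h𝓖]
    exact integral_mono_ae integrable_condExp ((integrable_norm_sq hG2).const_mul _) hε
  have hYm : StronglyMeasurable[𝓖] fun ω => D ω - a • (G ω + ((μ[g | 𝓖]) ω - G ω)) :=
    hD.sub ((hG.add hbm).const_smul a)
  have hY2 : MemLp (fun ω => D ω - a • (G ω + ((μ[g | 𝓖]) ω - G ω))) 2 μ :=
    hD2.sub ((hG2.add hb2).const_smul a)
  have hsplit : ∫ ω, ‖D ω - a • g ω‖ ^ 2 ∂μ
      = ∫ ω, ‖D ω - a • (G ω + ((μ[g | 𝓖]) ω - G ω))‖ ^ 2 ∂μ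
        + a ^ 2 * ∫ ω, ‖g ω - (μ[g | 𝓖]) ω‖ ^ 2 ∂μ := by
    rw [← integral_norm_sub_smul_sq h𝓖 hYm hY2 hg a]
    congr 1
    funext ω
    congr 2
    module
  have iD := integrable_norm_sq hD2
  have iY := integrable_norm_sq hY2
  rw [hsplit]
  constructor
  · rw [← integral_const_mul]
    have h0 : 0 ≤ a ^ 2 * ∫ ω, ‖g ω - (μ[g | 𝓖]) ω‖ ^ 2 ∂μ :=
      mul_nonneg (sq_nonneg _) (integral_nonneg fun _ => sq_nonneg _)
    refine le_add_of_le_of_nonneg (integral_mono_ae (iD.const_mul _) iY ?_) h0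
    filter_upwards [hb'] with ω hω
    exact step_lower hθ ha₀ hc (hLip ω) hω
  · have iG := ((integrable_norm_sq hG2).const_mul (θ ^ 2)).const_mul (a ^ 2)
    calc _ ≤ ∫ ω, ‖D ω - a • (G ω + ((μ[g | 𝓖]) ω - G ω))‖ ^ 2 ∂μ
          + a ^ 2 * ∫ ω, θ ^ 2 * ‖G ω‖ ^ 2 ∂μ := by gcongr
      _ = ∫ ω, (‖D ω - a • (G ω + ((μ[g | 𝓖]) ω - G ω))‖ ^ 2
          + a ^ 2 * (θ ^ 2 * ‖G ω‖ ^ 2)) ∂μ := by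
          rw [integral_add iY iG, integral_const_mul (a ^ 2)]
      _ ≤ ∫ ω, rate m M θ a * ‖D ω‖ ^ 2 ∂μ := by
          refine integral_mono_ae (iY.add iG) (iD.const_mul _) ?_
          filter_upwards [hb'] with ω hω
          exact step_upper hM hθ ha₀ ha (hLip ω) (h₁ ω) (h₂ ω) hω
      _ = _ := integral_const_mul _ _

end OneStep

/-! ### Expected batch sizes -/

section Batch

variable {Ω : Type*} {mΩ : MeasurableSpace Ω} {μ : Measure Ω}

/-- The negative part can only lower the left side. This lets a possibly negative tangent line be
compared with a batch size whose expectation may be infinite. -/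
lemma ofReal_integral_le_lintegral_ofReal {f : Ω → ℝ} (hf : Integrable f μ) :
    ENNReal.ofReal (∫ ω, f ω ∂μ) ≤ ∫⁻ ω, ENNReal.ofReal (f ω) ∂μ := by
  rw [integral_eq_lintegral_pos_part_sub_lintegral_neg_part hf]
  exact (ENNReal.ofReal_le_ofReal (sub_le_self _ ENNReal.toReal_nonneg)).trans
    ENNReal.ofReal_toReal_le

/-- The tangent line of `z ↦ z ^ (-3/2)` at `t` lies below the graph. -/
lemma tangent_le_rpow {z t : ℝ} (hz : 0 < z) (ht : 0 < t) :
    t ^ (-(3 / 2) : ℝ) * (1 - 3 / 2 * (z / t - 1)) ≤ z ^ (-(3 / 2) : ℝ) := by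
  have hu : 0 < z / t := div_pos hz ht
  -- With u = z/t: exp(−(3/2) log u) ≥ 1 − (3/2) log u, and log u ≤ u − 1.
  have h1 : 1 - 3 / 2 * (z / t - 1) ≤ (z / t) ^ (-(3 / 2) : ℝ) := by
    rw [Real.rpow_def_of_pos hu]
    have h2 := Real.add_one_le_exp (Real.log (z / t) * (-(3 / 2)))
    have h3 := Real.log_le_sub_one_of_pos hu
    linarith
  calc t ^ (-(3 / 2) : ℝ) * (1 - 3 / 2 * (z / t - 1))
      ≤ t ^ (-(3 / 2) : ℝ) * (z / t) ^ (-(3 / 2) : ℝ) := by gcongr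
    _ = z ^ (-(3 / 2) : ℝ) := by
        rw [← Real.mul_rpow ht.le hu.le, mul_div_cancel₀ _ ht.ne']

/-- Lower bound on the expected batch size from the sampling condition `C n^(-2/3) ≤ H`. -/
lemma ofReal_rpow_le_lintegral_batch [IsProbabilityMeasure μ] {C H : Ω → ℝ} {n : Ω → ℕ}
    (hn : Measurable n) (hn0 : ∀ ω, 0 < n ω) (hC : 0 < ∫ ω, C ω ∂μ) (hCint : Integrable C μ)
    (hCn : IndepFun C n μ) (hH : Integrable H μ)
    (hle : ∀ᵐ ω ∂μ, C ω * (n ω : ℝ) ^ (-(2 / 3) : ℝ) ≤ H ω) {t : ℝ} (ht : 0 < t)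
    (hHt : (∫ ω, H ω ∂μ) / ∫ ω, C ω ∂μ ≤ t) :
    ENNReal.ofReal (t ^ (-(3 / 2) : ℝ)) ≤ ∫⁻ ω, (n ω : ℝ≥0∞) ∂μ := by
  set Z : Ω → ℝ := fun ω => (n ω : ℝ) ^ (-(2 / 3) : ℝ) with hZdef
  have hφ : Measurable fun j : ℕ => (j : ℝ) ^ (-(2 / 3) : ℝ) := measurable_from_top
  have hZm : Measurable Z := hφ.comp hn
  have hn1 : ∀ ω, (1 : ℝ) ≤ n ω := fun ω => by exact_mod_cast hn0 ω
  have hZ0 : ∀ ω, 0 < Z ω := fun ω => Real.rpow_pos_of_pos (zero_lt_one.trans_le (hn1 ω)) _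
  have hZ1 : ∀ ω, Z ω ≤ 1 := fun ω => Real.rpow_le_one_of_one_le_of_nonpos (hn1 ω) (by norm_num)
  have hZb : ∀ ω, ‖Z ω‖ ≤ 1 := fun ω => by
    rw [Real.norm_of_nonneg (hZ0 ω).le]; exact hZ1 ω
  have hZi : Integrable Z μ :=
    Integrable.of_bound hZm.aestronglyMeasurable 1 (Filter.Eventually.of_forall hZb)
  have hCZ : IndepFun C Z μ := hCn.comp measurable_id hφ
  have hCZi : Integrable (fun ω => C ω * Z ω) μ := hCZ.integrable_mul hCint hZi
  -- Independence factors E[CZ], which turns the sampling rule into E Z ≤ t.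
  have hprod : (∫ ω, C ω ∂μ) * ∫ ω, Z ω ∂μ ≤ ∫ ω, H ω ∂μ := by
    rw [← hCZ.integral_fun_mul_eq_mul_integral hCint.1 hZi.1]
    exact integral_mono_ae hCZi hH hle
  have hZt : ∫ ω, Z ω ∂μ ≤ t := by
    refine le_trans ?_ hHt
    rw [le_div_iff₀ hC, mul_comm]
    exact hprod
  have hpow : ∀ ω, Z ω ^ (-(3 / 2) : ℝ) = n ω := fun ω => by
    rw [hZdef]
    simp only
    rw [← Real.rpow_mul (Nat.cast_nonneg _)]
    norm_num
  have i1 : Integrable (fun ω => Z ω / t - 1) μ := (hZi.div_const t).sub (integrable_const _)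
  have i2 : Integrable (fun ω => 1 - 3 / 2 * (Z ω / t - 1)) μ :=
    (integrable_const _).sub (i1.const_mul _)
  have hint := i2.const_mul (t ^ (-(3 / 2) : ℝ))
  have hval : ∫ ω, t ^ (-(3 / 2) : ℝ) * (1 - 3 / 2 * (Z ω / t - 1)) ∂μ
      = t ^ (-(3 / 2) : ℝ) * (1 - 3 / 2 * ((∫ ω, Z ω ∂μ) / t - 1)) := by
    rw [integral_const_mul, integral_sub (integrable_const _) (i1.const_mul _),
      integral_const_mul, integral_sub (hZi.div_const t) (integrable_const _), integral_div]
    simp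
  have ht' : 0 < t ^ (-(3 / 2) : ℝ) := Real.rpow_pos_of_pos ht _
  -- Jensen by hand, with the tangent taken at t instead of E Z: its slope is negative, so E Z ≤ t
  -- suffices.
  calc ENNReal.ofReal (t ^ (-(3 / 2) : ℝ))
      ≤ ENNReal.ofReal (∫ ω, t ^ (-(3 / 2) : ℝ) * (1 - 3 / 2 * (Z ω / t - 1)) ∂μ) := by
        refine ENNReal.ofReal_le_ofReal ?_
        rw [hval]
        have h1 : (∫ ω, Z ω ∂μ) / t ≤ 1 := (div_le_one ht).2 hZt
        exact le_mul_of_one_le_right ht'.le (by linarith)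
    _ ≤ ∫⁻ ω, ENNReal.ofReal (t ^ (-(3 / 2) : ℝ) * (1 - 3 / 2 * (Z ω / t - 1))) ∂μ :=
        ofReal_integral_le_lintegral_ofReal hint
    _ ≤ ∫⁻ ω, (n ω : ℝ≥0∞) ∂μ := by
        refine lintegral_mono fun ω => ?_
        rw [← ENNReal.ofReal_natCast, ← hpow ω]
        exact ENNReal.ofReal_le_ofReal (tangent_le_rpow (hZ0 ω) ht)

lemma totalEvals_eq_sum {d K : ℕ} {nb : ℕ → Ω → ℕ} (hnb : ∀ k, Measurable (nb k)) (N : ℕ) :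
    totalEvals μ d K nb N
      = ∑ k ∈ Finset.range N, 2 * (d : ℝ≥0∞) * ∫⁻ ω, (pairs K nb k ω : ℝ≥0∞) ∂μ := by
  have hm : ∀ k, Measurable fun ω => (pairs K nb k ω : ℝ≥0∞) := fun k =>
    (measurable_from_top (f := fun j : ℕ => ((K * j : ℕ) : ℝ≥0∞))).comp (hnb k)
  unfold totalEvals
  push_cast
  rw [lintegral_finsetSum _ fun k _ => (hm k).const_mul _]
  exact Finset.sum_congr rfl fun k _ => lintegral_const_mul _ (hm k)

end Batch

/-! ### Geometric sums and the constants C₁, C₂ -/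

section Sums

/-- A geometric sum dominates the corresponding integral. -/
lemma pow_div_sub_one_le_log_mul_sum {q : ℝ} (hq : 1 < q) (n : ℕ) :
    q ^ n / q - 1 ≤ Real.log q * ∑ k ∈ Finset.range n, q ^ k := by
  have hq0 : 0 < q := zero_lt_one.trans hq
  -- The integral runs up to n − 1, written as q^n / q; for n = 0 the left side is then simply
  -- nonpositive.
  cases n with
  | zero =>
    have : 1 / q ≤ 1 := (div_le_one hq0).2 hq.le
    simpa using this
  | succ j =>
    have hlog : q - 1 ≤ Real.log q * q := by
      have h1 := Real.one_sub_inv_le_log_of_pos hq0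
      have h2 := mul_le_mul_of_nonneg_right h1 hq0.le
      rwa [sub_mul, one_mul, inv_mul_cancel₀ hq0.ne'] at h2
    have hs : 0 ≤ ∑ k ∈ Finset.range j, q ^ k := Finset.sum_nonneg fun _ _ => by positivity
    calc q ^ (j + 1) / q - 1 = (q - 1) * ∑ k ∈ Finset.range j, q ^ k := by
          rw [pow_succ, mul_div_cancel_right₀ _ hq0.ne', mul_geom_sum]
      _ ≤ Real.log q * q * ∑ k ∈ Finset.range j, q ^ k := by gcongr
      _ ≤ Real.log q * ∑ k ∈ Finset.range (j + 1), q ^ k := by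
          rw [mul_assoc, geom_sum_succ]
          exact mul_le_mul_of_nonneg_left (by linarith) (Real.log_pos hq).le

lemma pow_rpow_comm {r : ℝ} (hr : 0 ≤ r) (n : ℕ) (s : ℝ) :
    (r ^ n) ^ s = (r ^ s) ^ n := by
  rw [← Real.rpow_natCast, ← Real.rpow_natCast, ← Real.rpow_mul hr, ← Real.rpow_mul hr, mul_comm]

/-- The costs grow with ratio q = ā^(-3/2). The upper limit of the comparison integral gives C₁, the
lower one C₂; log q = (3/2) log(1/ā) turns 2d into 4d/3, and stopping at n − 1 costs the factor q in
the denominator of C₁. -/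
lemma const₁_mul_add_const₂_le {d : ℕ} {Cbar M R abar ε : ℝ} (hP : 0 < Cbar * M ^ 2)
    (hR : 0 < R) (h0 : 0 < abar) (h1 : abar < 1) (n : ℕ)
    (hn : abar ^ n * R ≤ ε) :
    const₁ d Cbar M abar * ε ^ (-(3 / 2) : ℝ) + const₂ d Cbar M R abar
      ≤ ∑ k ∈ Finset.range n, 2 * d * (Cbar * M ^ 2 * (abar ^ k * R)) ^ (-(3 / 2) : ℝ) := by
  set q : ℝ := abar ^ (-(3 / 2) : ℝ) with hq
  set P := Cbar * M ^ 2 with hPdef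
  have hq1 : 1 < q := Real.one_lt_rpow_of_pos_of_lt_one_of_neg h0 h1 (by norm_num)
  have hlogq : Real.log q = 3 / 2 * Real.log (1 / abar) := by
    rw [hq, Real.log_rpow h0, one_div, Real.log_inv]; ring
  have hL : 0 < Real.log (1 / abar) := Real.log_pos (by rw [one_div]; exact (one_lt_inv₀ h0).2 h1)
  have hterm : ∀ k, (P * (abar ^ k * R)) ^ (-(3 / 2) : ℝ)
      = P ^ (-(3 / 2) : ℝ) * R ^ (-(3 / 2) : ℝ) * q ^ k := fun k => by
    rw [Real.mul_rpow hP.le (by positivity), Real.mul_rpow (by positivity) hR.le,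
      pow_rpow_comm h0.le]
    ring
  have hε : ε ^ (-(3 / 2) : ℝ) ≤ q ^ n * R ^ (-(3 / 2) : ℝ) := by
    rw [hq, ← pow_rpow_comm h0.le, ← Real.mul_rpow (by positivity) hR.le]
    exact Real.rpow_le_rpow_of_nonpos (by positivity) hn (by norm_num)
  have hW : 0 < P ^ (-(3 / 2) : ℝ) := Real.rpow_pos_of_pos hP _
  have hq0 : 0 < q := zero_lt_one.trans hq1
  have hR' : 0 < R ^ (-(3 / 2) : ℝ) := Real.rpow_pos_of_pos hR _
  simp only [hterm]
  rw [← Finset.mul_sum, ← Finset.mul_sum, const₁, const₂, ← hPdef, ← hq,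
    Real.mul_rpow hP.le hR.le]
  set P' := P ^ (-(3 / 2) : ℝ)
  set R' := R ^ (-(3 / 2) : ℝ)
  set L := Real.log (1 / abar)
  calc 4 * d * P' / (3 * q * L) * ε ^ (-(3 / 2) : ℝ) + -(4 * d * (P' * R') / (3 * L))
      ≤ 4 * d * P' / (3 * q * L) * (q ^ n * R') + -(4 * d * (P' * R') / (3 * L)) := by gcongr
    _ = 2 * d * (P' * R') * ((q ^ n / q - 1) / Real.log q) := by
        rw [hlogq]; field_simp; ring
    _ ≤ 2 * d * (P' * R' * ∑ k ∈ Finset.range n, q ^ k) := by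
        rw [← mul_assoc (2 * (d : ℝ)) (P' * R')]
        refine mul_le_mul_of_nonneg_left ?_ (by positivity)
        rw [div_le_iff₀ (Real.log_pos hq1), mul_comm (Finset.sum _ _)]
        exact pow_div_sub_one_le_log_mul_sum hq1 n

end Sums

end CorCFD

namespace CorCFD

open scoped RealInnerProductSpace

/-! ### From the error recursion to total cost -/

section Recursion

variable {V : ℕ → ℝ}

lemma le_pow_mul_of_succ_le {r : ℝ} (hr : 0 ≤ r) (hV : ∀ k, V (k + 1) ≤ r * V k) (k j : ℕ) :
    V (k + j) ≤ r ^ j * V k := by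
  induction j with
  | zero => simp
  | succ j ih =>
    calc V (k + (j + 1)) ≤ r * V (k + j) := hV (k + j)
      _ ≤ r * (r ^ j * V k) := by gcongr
      _ = r ^ (j + 1) * V k := by ring

lemma pos_of_le_succ {c : ℝ} (hc : 0 < c) (h0 : 0 < V 0) (hV : ∀ k, c * V k ≤ V (k + 1))
    (k : ℕ) : 0 < V k := by
  induction k with
  | zero => exact h0
  | succ k ih => exact (mul_pos hc ih).trans_le (hV k)

lemma pow_iterations_mul_le {r R ε : ℝ} (h1 : r < 1) (hε : 0 < ε) (hR : 0 < R) :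
    r ^ iterations r R ε * R ≤ ε := by
  -- `sInf` on ℕ is attained only on a nonempty set; on the empty set it defaults to 0.
  have hne : {k : ℕ | r ^ k * R ≤ ε}.Nonempty := by
    obtain ⟨k, hk⟩ := exists_pow_lt_of_lt_one (div_pos hε hR) h1
    exact ⟨k, ((lt_div_iff₀ hR).1 hk).le⟩
  exact Nat.sInf_mem hne

variable {d : ℕ} {e : ℕ → ℝ≥0∞}

/-- Cost of the first `n` iterations when the error decays at least at rate `r`. -/
lemma ofReal_const_le_sum {Cbar M R r ε : ℝ} (hP : 0 < Cbar * M ^ 2) (hR : 0 < R) (h0 : 0 < r)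
    (h1 : r < 1) (hVpos : ∀ k, 0 < V k) (hV0 : V 0 = R) (hV : ∀ k, V (k + 1) ≤ r * V k)
    (he : ∀ k, ENNReal.ofReal ((Cbar * M ^ 2 * V k) ^ (-(3 / 2) : ℝ)) ≤ e k) (n : ℕ)
    (hn : r ^ n * R ≤ ε) :
    ENNReal.ofReal (const₁ d Cbar M r * ε ^ (-(3 / 2) : ℝ) + const₂ d Cbar M R r)
      ≤ ∑ k ∈ Finset.range n, 2 * (d : ℝ≥0∞) * e k := by
  refine (ENNReal.ofReal_le_ofReal (const₁_mul_add_const₂_le hP hR h0 h1 n hn)).trans ?_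
  rw [ENNReal.ofReal_sum_of_nonneg fun k _ => by positivity]
  refine Finset.sum_le_sum fun k _ => ?_
  rw [ENNReal.ofReal_mul (by positivity), ENNReal.ofReal_mul (by positivity),
    ENNReal.ofReal_natCast, ENNReal.ofReal_ofNat]
  gcongr
  refine le_trans (ENNReal.ofReal_le_ofReal ?_) (he k)
  have hk := le_pow_mul_of_succ_le h0.le hV 0 k
  rw [zero_add, hV0] at hk
  refine Real.rpow_le_rpow_of_nonpos (mul_pos hP (hVpos k)) ?_ (by norm_num)
  gcongr

/-- Cost of the last iteration before accuracy `ε`. -/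
lemma ofReal_accuracy_le_sum {P c R ε : ℝ} (hP : 0 < P) (hc : 0 < c) (hε : 0 < ε) (hεR : ε < R)
    (hVpos : ∀ k, 0 < V k) (hV0 : V 0 = R) (hV : ∀ k, c ^ 2 * V k ≤ V (k + 1))
    (he : ∀ k, ENNReal.ofReal ((P * V k) ^ (-(3 / 2) : ℝ)) ≤ e k) (N : ℕ) (hN : V N ≤ ε) :
    ENNReal.ofReal (2 * d * P ^ (-(3 / 2) : ℝ) * c ^ 3 * ε ^ (-(3 / 2) : ℝ))
      ≤ ∑ k ∈ Finset.range N, 2 * (d : ℝ≥0∞) * e k := by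
  cases N with
  | zero => rw [hV0] at hN; exact absurd hN hεR.not_ge
  | succ j =>
    -- Iteration j is the last one run; one step shrinks the error by at most c², and c³ below is
    -- (c²)^(3/2).
    have hj : V j ≤ ε / c ^ 2 := by
      rw [le_div_iff₀ (by positivity), mul_comm]
      exact (hV j).trans hN
    have hc3 : (c ^ 2) ^ (-(3 / 2) : ℝ) = (c ^ 3)⁻¹ := by
      rw [← Real.rpow_natCast, ← Real.rpow_natCast, ← Real.rpow_mul hc.le, ← Real.rpow_neg hc.le]
      norm_num
    have h1 : P ^ (-(3 / 2) : ℝ) * c ^ 3 * ε ^ (-(3 / 2) : ℝ) ≤ (P * V j) ^ (-(3 / 2) : ℝ) := by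
      calc P ^ (-(3 / 2) : ℝ) * c ^ 3 * ε ^ (-(3 / 2) : ℝ)
          = (P * (ε / c ^ 2)) ^ (-(3 / 2) : ℝ) := by
            rw [Real.mul_rpow hP.le (by positivity), Real.div_rpow hε.le (by positivity), hc3,
              div_inv_eq_mul]
            ring
        _ ≤ (P * V j) ^ (-(3 / 2) : ℝ) :=
            Real.rpow_le_rpow_of_nonpos (mul_pos hP (hVpos j)) (by gcongr) (by norm_num)
    calc ENNReal.ofReal (2 * d * P ^ (-(3 / 2) : ℝ) * c ^ 3 * ε ^ (-(3 / 2) : ℝ))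
        = 2 * (d : ℝ≥0∞) * ENNReal.ofReal (P ^ (-(3 / 2) : ℝ) * c ^ 3 * ε ^ (-(3 / 2) : ℝ)) := by
          rw [mul_assoc, mul_assoc, ENNReal.ofReal_mul (by positivity),
            ENNReal.ofReal_mul (by positivity), ENNReal.ofReal_natCast, ENNReal.ofReal_ofNat,
            ← mul_assoc (P ^ _)]
      _ ≤ 2 * (d : ℝ≥0∞) * e j := by
          gcongr
          exact (ENNReal.ofReal_le_ofReal h1).trans (he j)
      _ ≤ _ := Finset.single_le_sum (f := fun k => 2 * (d : ℝ≥0∞) * e k)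
          (fun _ _ => zero_le) (Finset.self_mem_range_succ j)

/-- Under a cost of order `V k ^ (-3/2)` per iteration, the error after a total cost `S` is of
order `S ^ (-2/3)`. -/
lemma isBigO_sum_rpow {P B r : ℝ} (hd : 0 < d) (hP : 0 < P) (hB : 0 ≤ B) (h0 : 0 < r) (h1 : r < 1)
    (hVpos : ∀ k, 0 < V k) (hV : ∀ k, V (k + 1) ≤ r * V k) (he0 : ∀ k, e k ≠ 0)
    (he : ∀ k, e k ≤ ENNReal.ofReal (B * (P * V k) ^ (-(3 / 2) : ℝ))) :
    (∀ N, ∑ k ∈ Finset.range N, 2 * (d : ℝ≥0∞) * e k ≠ ∞) ∧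
      V =O[Filter.atTop]
        fun N => (∑ k ∈ Finset.range N, 2 * (d : ℝ≥0∞) * e k).toReal ^ (-(2 / 3) : ℝ) := by
  have hfin : ∀ N, ∑ k ∈ Finset.range N, 2 * (d : ℝ≥0∞) * e k ≠ ∞ := fun N =>
    ENNReal.sum_ne_top.2 fun k _ => ENNReal.mul_ne_top
      (ENNReal.mul_ne_top (by simp) (by simp)) ((he k).trans_lt ENNReal.ofReal_lt_top).ne
  refine ⟨hfin, ?_⟩
  set s : ℝ := r ^ (3 / 2 : ℝ) with hs
  have hs0 : 0 < s := Real.rpow_pos_of_pos h0 _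
  have hs1 : s < 1 := Real.rpow_lt_one h0.le h1 (by norm_num)
  set Q : ℝ := 2 * d * (B * P ^ (-(3 / 2) : ℝ)) * (1 - s)⁻¹ with hQ
  have hs1' : 0 < 1 - s := by linarith
  have hQ0 : 0 ≤ Q := by positivity
  have hbound : ∀ N, (∑ k ∈ Finset.range N, 2 * (d : ℝ≥0∞) * e k).toReal
      ≤ Q * V N ^ (-(3 / 2) : ℝ) := by
    intro N
    have hN := hVpos N
    refine ENNReal.toReal_le_of_le_ofReal (by positivity) ?_
    have hterm : ∀ k ∈ Finset.range N, 2 * (d : ℝ≥0∞) * e k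
        ≤ ENNReal.ofReal (2 * d * (B * P ^ (-(3 / 2) : ℝ)) * V N ^ (-(3 / 2) : ℝ)
          * s ^ (N - 1 - k)) := by
      intro k hk
      have hkN : k < N := Finset.mem_range.1 hk
      -- The true exponent is N − k; one factor r is given up so that the sum is a reflected
      -- `Finset.range N`.
      have hVk : V N ≤ r ^ (N - 1 - k) * V k := by
        have h2 := le_pow_mul_of_succ_le h0.le hV k (N - k)
        rw [Nat.add_sub_cancel' hkN.le] at h2
        refine h2.trans (mul_le_mul_of_nonneg_right ?_ (hVpos k).le)
        exact pow_le_pow_of_le_one h0.le h1.le (by omega)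
      have h3 : V k ^ (-(3 / 2) : ℝ) ≤ V N ^ (-(3 / 2) : ℝ) * s ^ (N - 1 - k) := by
        have h4 := Real.rpow_le_rpow_of_nonpos (hVpos N) hVk
          (by norm_num : (-(3 / 2) : ℝ) ≤ 0)
        rw [Real.mul_rpow (by positivity) (hVpos k).le, pow_rpow_comm h0.le,
          Real.rpow_neg h0.le, ← hs, inv_pow, inv_mul_le_iff₀ (by positivity)] at h4
        linarith
      have hk0 := hVpos k
      calc 2 * (d : ℝ≥0∞) * e k
          ≤ 2 * (d : ℝ≥0∞) * ENNReal.ofReal (B * (P * V k) ^ (-(3 / 2) : ℝ)) := by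
            gcongr
            exact he k
        _ = ENNReal.ofReal (2 * d * (B * (P * V k) ^ (-(3 / 2) : ℝ))) := by
            rw [ENNReal.ofReal_mul (p := 2 * (d : ℝ)) (by positivity),
              ENNReal.ofReal_mul (p := 2) (by positivity), ENNReal.ofReal_natCast,
              ENNReal.ofReal_ofNat]
        _ ≤ _ := by
            refine ENNReal.ofReal_le_ofReal ?_
            rw [Real.mul_rpow hP.le (hVpos k).le]
            calc 2 * d * (B * (P ^ (-(3 / 2) : ℝ) * V k ^ (-(3 / 2) : ℝ)))
                = 2 * d * (B * P ^ (-(3 / 2) : ℝ)) * V k ^ (-(3 / 2) : ℝ) := by ring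
              _ ≤ 2 * d * (B * P ^ (-(3 / 2) : ℝ)) * (V N ^ (-(3 / 2) : ℝ) * s ^ (N - 1 - k)) := by
                  gcongr
              _ = _ := by ring
    refine (Finset.sum_le_sum hterm).trans ?_
    rw [← ENNReal.ofReal_sum_of_nonneg fun k _ => by positivity]
    refine ENNReal.ofReal_le_ofReal ?_
    rw [← Finset.mul_sum, Finset.sum_range_reflect (fun j => s ^ j) N, hQ]
    have hgeom : ∑ j ∈ Finset.range N, s ^ j ≤ (1 - s)⁻¹ := by
      rw [← tsum_geometric_of_lt_one hs0.le hs1]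
      exact (summable_geometric_of_lt_one hs0.le hs1).sum_le_tsum _ fun _ _ => by positivity
    calc _ ≤ 2 * d * (B * P ^ (-(3 / 2) : ℝ)) * V N ^ (-(3 / 2) : ℝ) * (1 - s)⁻¹ := by gcongr
      _ = _ := by ring
  refine Asymptotics.IsBigO.of_bound (Q ^ (2 / 3 : ℝ)) ?_
  -- At N = 0 the cost is 0 and `0 ^ (-(2 / 3))` is 0 by convention, so the bound would fail there.
  filter_upwards [Filter.eventually_ge_atTop 1] with N hN1
  set S := (∑ k ∈ Finset.range N, 2 * (d : ℝ≥0∞) * e k).toReal with hS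
  have hN := hVpos N
  have hSpos : 0 < S := by
    refine ENNReal.toReal_pos ?_ (hfin N)
    rw [Ne, Finset.sum_eq_zero_iff]
    intro hz
    have := hz 0 (Finset.mem_range.2 hN1)
    simp [he0 0, hd.ne'] at this
  rw [Real.norm_of_nonneg hN.le, Real.norm_of_nonneg (by positivity)]
  have h5 : V N ^ (3 / 2 : ℝ) ≤ Q * S⁻¹ := by
    have h6 := hbound N
    rw [← hS, Real.rpow_neg hN.le, ← div_eq_mul_inv, le_div_iff₀ (by positivity)] at h6
    rw [← div_eq_mul_inv, le_div_iff₀ hSpos]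
    linarith
  have h7 := Real.rpow_le_rpow (by positivity) h5 (by norm_num : (0 : ℝ) ≤ 2 / 3)
  rw [← Real.rpow_mul hN.le, Real.mul_rpow hQ0 (by positivity), Real.inv_rpow hSpos.le,
    ← Real.rpow_neg hSpos.le] at h7
  norm_num at h7
  norm_num
  exact h7

/-- Capping the cost needs the gradient bounded below, hence m² here against M² in the lower bounds
on cost. The absolute value covers A of any sign. -/
lemma mul_rpow_le_abs_mul_rpow {B m v I : ℝ} (hB : 0 < B) (hm : 0 < m) (hv : 0 < v)
    (hI : m ^ 2 * v ≤ I) (A : ℝ) :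
    A * (B * I) ^ (-(3 / 2) : ℝ) ≤ |A| * (B * m ^ 2 * v) ^ (-(3 / 2) : ℝ) := by
  have hI0 : 0 < I := lt_of_lt_of_le (by positivity) hI
  calc A * (B * I) ^ (-(3 / 2) : ℝ) ≤ |A| * (B * I) ^ (-(3 / 2) : ℝ) := by
        gcongr
        exact le_abs_self A
    _ ≤ |A| * (B * m ^ 2 * v) ^ (-(3 / 2) : ℝ) := by
        refine mul_le_mul_of_nonneg_left ?_ (abs_nonneg A)
        rw [mul_assoc]
        exact Real.rpow_le_rpow_of_nonpos (by positivity) (by gcongr) (by norm_num)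

end Recursion

/-! ### Measurability and moments along a run -/

section Run

variable {d K : ℕ} {Ω Ξ : Type*} [MeasurableSpace Ω] [MeasurableSpace Ξ]
  {F : EuclideanSpace ℝ (Fin d) → ℝ} {μ : Measure Ω} {O : NoisyOracle F Ξ}
  {ξ : EvalIndex d K → Ω → Ξ} {h : ℕ → Fin d → Fin K → Ω → ℝ} {nb : ℕ → Ω → ℕ} {a : ℝ}
  {x₀ : EuclideanSpace ℝ (Fin d)} {x : ℕ → Ω → EuclideanSpace ℝ (Fin d)}

lemma IsRun.history_le (hrun : IsRun μ O ξ h nb a x₀ x) (k : ℕ) :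
    history x k ≤ (inferInstance : MeasurableSpace Ω) :=
  iSup₂_le fun j _ => (hrun.measurable_iterate j).comap_le

/-- The history starts at x₁, so 𝓕₀ is trivial; x₀ is measurable there because it is deterministic.
-/
lemma IsRun.measurable_history (hrun : IsRun μ O ξ h nb a x₀ x) (k : ℕ) :
    Measurable[history x k] (x k) := by
  cases k with
  | zero =>
    have : x 0 = fun _ => x₀ := funext hrun.zero
    rw [this]
    exact measurable_const
  | succ k =>
    have hle : MeasurableSpace.comap (x (k + 1)) inferInstance ≤ history x (k + 1) :=
      le_iSup₂ (f := fun j (_ : j ∈ Finset.Icc 1 (k + 1)) =>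
        MeasurableSpace.comap (x j) inferInstance) (k + 1) (by simp)
    exact (comap_measurable (x (k + 1))).mono hle le_rfl

lemma IsRun.memLp (hrun : IsRun μ O ξ h nb a x₀ x) [IsFiniteMeasure μ]
    (hL2 : ∀ k, MemLp (gradEst O ξ h nb x k) 2 μ) (k : ℕ) : MemLp (x k) 2 μ := by
  induction k with
  | zero =>
    have : x 0 = fun _ => x₀ := funext hrun.zero
    rw [this]
    exact memLp_const _
  | succ k ih =>
    have : x (k + 1) = x k - a • gradEst O ξ h nb x k := funext (hrun.step k)
    rw [this]
    exact ih.sub ((hL2 k).const_smul a)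

lemma IsRun.pairs_pos (hrun : IsRun μ O ξ h nb a x₀ x) (k : ℕ) (ω : Ω) :
    0 < pairs K nb k ω :=
  Nat.mul_pos (zero_lt_two.trans_le hrun.two_le) (hrun.batch_pos k ω)

lemma IsRun.measurable_pairs (hrun : IsRun μ O ξ h nb a x₀ x) (k : ℕ) :
    Measurable (pairs K nb k) :=
  (measurable_from_top (f := fun j : ℕ => K * j)).comp (hrun.measurable_batch k)

end Run

end CorCFD

/-! ### The sample complexity theorem -/

theorem mainTheorem3 {d K : ℕ} (hd : 0 < d)
    {Ω Ξ : Type*} [MeasurableSpace Ω] [MeasurableSpace Ξ]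
    (μ : Measure Ω) [IsProbabilityMeasure μ]
    -- objective function: smoothness, Lipschitz gradient, strong convexity, minimizer
    (F : EuclideanSpace ℝ (Fin d) → ℝ) (hF : ContDiff ℝ 5 F)
    (m M : ℝ) (hm : 0 < m) (hM : 0 < M)
    (hLip : ∀ y z, ‖gradient F y - gradient F z‖ ≤ M * ‖y - z‖)
    (hconv : ∀ y (l : ℝ), Module.End.HasEigenvalue
      (fderiv ℝ (gradient F) y : EuclideanSpace ℝ (Fin d) →ₗ[ℝ] EuclideanSpace ℝ (Fin d)) l → m ≤ l)
    (xs : EuclideanSpace ℝ (Fin d)) (hxs : ∀ y, F xs ≤ F y)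
    -- bounded third derivative and bounded noise
    (h₃ : ∃ B₃ : ℝ, ∀ y, ‖iteratedFDeriv ℝ 3 F y‖ ≤ B₃)
    (O : CorCFD.NoisyOracle F Ξ) (hσ : ∃ s : ℝ, ∀ y, O.noise y ≤ s)
    -- threshold and step size
    (θ a : ℝ) (hθ₀ : 0 < θ) (hθ : θ < m / (2 * M))
    (ha₀ : 0 < a) (ha : a ≤ 1 / ((2 * θ ^ 2 + 2 * θ + 1) * M))
    -- a run of the algorithm
    (ξ : CorCFD.EvalIndex d K → Ω → Ξ) (h : ℕ → Fin d → Fin K → Ω → ℝ) (nb : ℕ → Ω → ℕ)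
    (x₀ : EuclideanSpace ℝ (Fin d)) (x : ℕ → Ω → EuclideanSpace ℝ (Fin d))
    (hrun : CorCFD.IsRun μ O ξ h nb a x₀ x)
    (hL2 : ∀ k, MemLp (CorCFD.gradEst O ξ h nb x k) 2 μ)
    -- bias and variance are at most `C n_k^{-2/3}`
    (C : Ω → ℝ) (hC : ∀ᵐ ω ∂μ, 0 < C ω) (hCint : Integrable C μ)
    (hCn : ∀ k, IndepFun C (CorCFD.pairs K nb k) μ)
    (hbv : ∀ k, ∀ᵐ ω ∂μ,
      max
        ((μ[fun ω' => ‖CorCFD.bias μ F x (CorCFD.gradEst O ξ h nb x) k ω'‖ ^ 2 |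
          CorCFD.history x k]) ω)
        ((μ[fun ω' => ‖CorCFD.noiseTerm μ x (CorCFD.gradEst O ξ h nb x) k ω'‖ ^ 2 |
          CorCFD.history x k]) ω)
      ≤ C ω * (CorCFD.pairs K nb k ω : ℝ) ^ (-(2 / 3) : ℝ))
    -- the batch size is taken so large that this bound meets the adaptive sampling condition
    (hbatch : ∀ k, ∀ᵐ ω ∂μ,
      C ω * (CorCFD.pairs K nb k ω : ℝ) ^ (-(2 / 3) : ℝ) ≤ θ ^ 2 * ‖gradient F (x k ω)‖ ^ 2)
    -- the constants
    (abar Cbar R : ℝ) (habar : abar = CorCFD.rate m M θ a)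
    (hCbar : Cbar = θ ^ 2 / ∫ ω, C ω ∂μ) (hR : R = ‖x₀ - xs‖ ^ 2) :
    -- cost of the iterations that the linear rate requires for accuracy `ε`
    (∀ ε : ℝ, 0 < ε →
      CorCFD.mse μ x xs (CorCFD.iterations abar R ε) ≤ ε ∧
      ENNReal.ofReal
          (CorCFD.const₁ d Cbar M abar * ε ^ (-(3 / 2) : ℝ) + CorCFD.const₂ d Cbar M R abar)
        ≤ CorCFD.totalEvals μ d K nb (CorCFD.iterations abar R ε)) ∧
    -- cost of any number of iterations after which the iterate is `ε`-accurate
    (0 < 1 - a * M * (1 + θ) ∧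
      ∀ ε : ℝ, 0 < ε → ε < R → ∀ N : ℕ, CorCFD.mse μ x xs N ≤ ε →
        ENNReal.ofReal
            (2 * d * (Cbar * M ^ 2) ^ (-(3 / 2) : ℝ) * (1 - a * M * (1 + θ)) ^ 3
              * ε ^ (-(3 / 2) : ℝ))
          ≤ CorCFD.totalEvals μ d K nb N) ∧
    -- mean squared error in terms of the budget, for batches of the smallest admissible order
    (∀ A : ℝ,
      (∀ k, ∫⁻ ω, (CorCFD.pairs K nb k ω : ℝ≥0∞) ∂μ ≤
        ENNReal.ofReal
          (A * (Cbar * ∫ ω, ‖gradient F (x k ω)‖ ^ 2 ∂μ) ^ (-(3 / 2) : ℝ))) →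
      (∀ N, CorCFD.totalEvals μ d K nb N ≠ ∞) ∧
      (fun N => CorCFD.mse μ x xs N) =O[Filter.atTop]
        (fun N => (CorCFD.totalEvals μ d K nb N).toReal ^ (-(2 / 3) : ℝ))) := by
  have hF2 : ContDiff ℝ 2 F := hF.of_le (by norm_num)
  have hgs : gradient F xs = 0 := CorCFD.gradient_eq_zero_of_isMin hxs
  have hgLip : ∀ y, ‖gradient F y‖ ≤ M * ‖y - xs‖ := fun y => by simpa [hgs] using hLip y xs
  have hgb : ∀ y, m * ‖y - xs‖ ^ 2 ≤ inner ℝ (gradient F y) (y - xs) ∧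
      ‖gradient F y‖ ^ 2 ≤ M * inner ℝ (gradient F y) (y - xs) := fun y => by
    simpa [hgs] using CorCFD.gradient_bounds hF2 hm hM.le hLip hconv xs y
  have hgm : ∀ y, m * ‖y - xs‖ ≤ ‖gradient F y‖ := fun y => by
    rcases (norm_nonneg (y - xs)).eq_or_lt with h0 | h0
    · rw [← h0, mul_zero]; exact norm_nonneg _
    · refine le_of_mul_le_mul_right ?_ h0
      calc m * ‖y - xs‖ * ‖y - xs‖ = m * ‖y - xs‖ ^ 2 := by ring
        _ ≤ _ := (hgb y).1.trans (real_inner_le_norm _ _)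
  have hgcont : Continuous (gradient F) := (CorCFD.differentiable_gradient hF2).continuous
  -- the initial point is not the minimizer
  have hne : x₀ ≠ xs := by
    rintro rfl
    -- Starting at x*, the sampling rule would bound a positive quantity by θ²‖∇F(x*)‖² = 0.
    obtain ⟨ω, h1, h2⟩ := (hC.and (hbatch 0)).exists
    rw [hrun.zero, hgs] at h2
    have hp : (0 : ℝ) < CorCFD.pairs K nb 0 ω := by exact_mod_cast hrun.pairs_pos 0 ω
    have := mul_pos h1 (Real.rpow_pos_of_pos hp (-(2 / 3)))
    simp at h2
    linarith
  have hn0 : 0 < ‖x₀ - xs‖ := norm_pos_iff.2 (sub_ne_zero.2 hne)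
  have hR0 : 0 < R := by rw [hR]; positivity
  have hmM : m ≤ M := le_of_mul_le_mul_right ((hgm x₀).trans (hgLip x₀)) hn0
  -- consequences of the step size rule
  have ha' : a * ((2 * θ ^ 2 + 2 * θ + 1) * M) ≤ 1 := (le_div_iff₀ (by positivity)).1 ha
  have haM : 0 < a * M := mul_pos ha₀ hM
  -- 2θ² + 2θ + 1 exceeds 1 + θ by 2θ² + θ > 0.
  have hc : 0 < 1 - a * M * (1 + θ) := by
    have h1 : 0 < a * M * (2 * θ ^ 2 + θ) := by positivity
    linarith
  have hθM : 2 * θ * M < m := by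
    rw [lt_div_iff₀ (by positivity)] at hθ
    linarith
  have hr1 : abar < 1 := by
    rw [habar, CorCFD.rate]
    linarith [mul_pos (sub_pos.2 hθM) ha₀]
  have hr0 : 0 < abar := by
    have h1 : m * a ≤ M * a := by gcongr
    have h2 : 0 < a * M * (2 * θ ^ 2 + 2 * θ) := by positivity
    have h3 : 0 < 2 * θ * M * a := by positivity
    rw [habar, CorCFD.rate]
    linarith
  have hIC : 0 < ∫ ω, C ω ∂μ := by
    rw [integral_pos_iff_support_of_nonneg_ae (hC.mono fun _ h => h.le) hCint]
    have h1 : Function.support C =ᵐ[μ] Set.univ := by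
      filter_upwards [hC] with ω hω
      exact propext (iff_of_true hω.ne' trivial)
    rw [measure_congr h1, measure_univ]
    exact one_pos
  have hCbar0 : 0 < Cbar := by rw [hCbar]; positivity
  have hCC : Cbar * ∫ ω, C ω ∂μ = θ ^ 2 := by rw [hCbar, div_mul_cancel₀ _ hIC.ne']
  -- second moments
  have hx2 : ∀ k, MemLp (x k) 2 μ := hrun.memLp hL2
  have hD2 : ∀ k, MemLp (fun ω => x k ω - xs) 2 μ := fun k => (hx2 k).sub (memLp_const _)
  have hDm : ∀ k, StronglyMeasurable[CorCFD.history x k] fun ω => x k ω - xs := fun k =>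
    ((hrun.measurable_history k).sub_const xs).stronglyMeasurable
  have hGm : ∀ k, StronglyMeasurable[CorCFD.history x k] fun ω => gradient F (x k ω) := fun k =>
    (hgcont.measurable.comp (hrun.measurable_history k)).stronglyMeasurable
  have hG2 : ∀ k, MemLp (fun ω => gradient F (x k ω)) 2 μ := fun k =>
    (hD2 k).of_le_mul ((hGm k).mono (hrun.history_le k)).aestronglyMeasurable
      (Filter.Eventually.of_forall fun ω => hgLip _)
  have hIG : ∀ k, m ^ 2 * CorCFD.mse μ x xs k ≤ ∫ ω, ‖gradient F (x k ω)‖ ^ 2 ∂μ ∧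
      ∫ ω, ‖gradient F (x k ω)‖ ^ 2 ∂μ ≤ M ^ 2 * CorCFD.mse μ x xs k := fun k => by
    have iD := CorCFD.integrable_norm_sq (hD2 k)
    have iG := CorCFD.integrable_norm_sq (hG2 k)
    rw [CorCFD.mse, ← integral_const_mul, ← integral_const_mul]
    constructor
    · refine integral_mono (iD.const_mul _) iG fun ω => ?_
      simp only
      rw [← mul_pow]
      gcongr
      exact hgm _
    · refine integral_mono iG (iD.const_mul _) fun ω => ?_
      simp only
      rw [← mul_pow]
      gcongr
      exact hgLip _
  -- the recursion for the mean squared error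
  have hstep : ∀ k, (1 - a * M * (1 + θ)) ^ 2 * CorCFD.mse μ x xs k ≤ CorCFD.mse μ x xs (k + 1) ∧
      CorCFD.mse μ x xs (k + 1) ≤ abar * CorCFD.mse μ x xs k := fun k => by
    -- Chaining the two inequalities eliminates C and n_k: the error recursion sees only
    -- θ²‖∇F(x_k)‖².
    have hbound : ∀ᵐ ω ∂μ, _ := (hbv k).mp ((hbatch k).mono fun ω h1 h2 => h2.trans h1)
    have hnext : CorCFD.mse μ x xs (k + 1)
        = ∫ ω, ‖(x k ω - xs) - a • CorCFD.gradEst O ξ h nb x k ω‖ ^ 2 ∂μ := by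
      rw [CorCFD.mse]
      simp only [hrun.step k, sub_right_comm]
    rw [hnext, habar]
    exact CorCFD.integral_norm_sub_smul_sq_bounds (hrun.history_le k) hM hθ₀.le ha₀.le ha' hc.le
      (hDm k) (hGm k) (hD2 k) (hL2 k) (fun ω => hgLip _) (fun ω => (hgb _).1)
      (fun ω => (hgb _).2) (hbound.mono fun ω h1 => (le_max_left _ _).trans h1)
      (hbound.mono fun ω h1 => (le_max_right _ _).trans h1)
  have hV0 : CorCFD.mse μ x xs 0 = R := by
    rw [CorCFD.mse]
    simp [hrun.zero, hR]
  have hVpos : ∀ k, 0 < CorCFD.mse μ x xs k :=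
    CorCFD.pos_of_le_succ (pow_pos hc 2) (hV0 ▸ hR0) fun k => (hstep k).1
  have hP : 0 < Cbar * M ^ 2 := by positivity
  -- the expected batch sizes
  have hbatchLB : ∀ k, ENNReal.ofReal ((Cbar * M ^ 2 * CorCFD.mse μ x xs k) ^ (-(3 / 2) : ℝ))
      ≤ ∫⁻ ω, (CorCFD.pairs K nb k ω : ℝ≥0∞) ∂μ := fun k => by
    -- Here H = θ²‖∇F(x_k)‖² and t = C̄M²V_k, which dominates E H / E C because C̄ E C = θ².
    refine CorCFD.ofReal_rpow_le_lintegral_batch (hrun.measurable_pairs k) (hrun.pairs_pos k) hIC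
      hCint (hCn k) ((CorCFD.integrable_norm_sq (hG2 k)).const_mul (θ ^ 2)) (hbatch k)
      (mul_pos hP (hVpos k)) ?_
    rw [integral_const_mul, div_le_iff₀ hIC]
    calc θ ^ 2 * ∫ ω, ‖gradient F (x k ω)‖ ^ 2 ∂μ
        ≤ θ ^ 2 * (M ^ 2 * CorCFD.mse μ x xs k) :=
          mul_le_mul_of_nonneg_left (hIG k).2 (sq_nonneg θ)
      _ = Cbar * M ^ 2 * CorCFD.mse μ x xs k * ∫ ω, C ω ∂μ := by
          rw [← hCC]; ring
  have htot := CorCFD.totalEvals_eq_sum (μ := μ) (d := d) (K := K) hrun.measurable_batch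
  refine ⟨fun ε hε => ?_, ⟨hc, fun ε hε hεR N hN => ?_⟩, fun A hA => ?_⟩
  · have hK := CorCFD.pow_iterations_mul_le hr1 hε hR0
    constructor
    · have h1 := CorCFD.le_pow_mul_of_succ_le (V := CorCFD.mse μ x xs) hr0.le
        (fun k => (hstep k).2) 0 (CorCFD.iterations abar R ε)
      rw [zero_add, hV0] at h1
      exact h1.trans hK
    · rw [htot]
      exact CorCFD.ofReal_const_le_sum (V := CorCFD.mse μ x xs)
        (e := fun k => ∫⁻ ω, (CorCFD.pairs K nb k ω : ℝ≥0∞) ∂μ) hP hR0 hr0 hr1 hVpos hV0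
        (fun k => (hstep k).2) hbatchLB _ hK
  · rw [htot]
    exact CorCFD.ofReal_accuracy_le_sum (V := CorCFD.mse μ x xs)
      (e := fun k => ∫⁻ ω, (CorCFD.pairs K nb k ω : ℝ≥0∞) ∂μ) hP hc hε hεR hVpos hV0
      (fun k => (hstep k).1) hbatchLB N hN
  · simp only [htot]
    refine CorCFD.isBigO_sum_rpow (V := CorCFD.mse μ x xs)
      (e := fun k => ∫⁻ ω, (CorCFD.pairs K nb k ω : ℝ≥0∞) ∂μ)
      (P := Cbar * m ^ 2) (B := |A|) hd (by positivity) (abs_nonneg A)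
      hr0 hr1 hVpos (fun k => (hstep k).2) (fun k => ?_) fun k => (hA k).trans ?_
    · refine (lt_of_lt_of_le ?_ (hbatchLB k)).ne'
      exact ENNReal.ofReal_pos.2 (Real.rpow_pos_of_pos (mul_pos hP (hVpos k)) _)
    · exact ENNReal.ofReal_le_ofReal
        (CorCFD.mul_rpow_le_abs_mul_rpow hCbar0 hm (hVpos k) (hIG k).1 A)
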